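/- Let $n\ge 0$ be an integer, let $(U,\rho)$ be a separable metric space which is a Suslin space (i.e. empty or a continuous image of a Polish space; this holds for instance if $U$ is complete, or is a Borel subset of some $\mathbb R^m$), and let $y_0\in\mathbb R^n$. "Measurable" means Lebesgue measurable on the time axis and Borel measurable on $U$; $|\cdot|$ is the Euclidean norm and $\|\cdot\|$ the associated operator norm on $n\times n$ matrices. Assume: * $G:[0,\infty)^2\to\mathbb R$: for each $r\ge0$, $G(\cdot,r)$ is measurable; for each $t\ge 0$, $G(t,\cdot)$ is continuously differentiable on $[0,\infty)$ and $G(t,0)=0$; and $\sup_{(t,r)\in[0,M]^2}|\partial G(t,r)/\partial r|<\infty$ for every $M>0$. * $A:[0,\infty)\to\mathbb R^{n\times n}$ is measurable and $\operatorname{ess\,sup}_{t\in[0,T]}\|A(t)\|<\infty$ for every $T>0$. * $b:[0,\infty)\times U\to\mathbb R^n$ is measurable in $t$ for each $u\in U$ and continuous in $u$ for each $t\ge0$; for each $t\ge 0$ the set $b(t,U)=\{b(t,u):u\in U\}$ is convex and compact; and for every $T>0$ there is a constant $C_T$ such that, for almost every $t\in[0,T]$, $|b(t,u)|\le C_T$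 for all $u\in U$. Consider the controlled system $$y'(t)=f(t,y(t),u(t)),\quad y(0)=y_0,\qquad f(t,y,u)=G(t,|y|)\frac{y}{|y|}+A(t)y+b(t,u),$$ where the first term of $f$ is read as $0$ at $y=0$. Let $\mathcal U$ be the set of measurable functions $u:[0,\infty)\to U$. Let $\mathcal P$ be the set of triples $(T,y,u)$ with $T\in(0,\infty)$, $y\in C([0,T);\mathbb R^n)$ and $u\in\mathcal U$ such that $y(t)=y_0+\int_0^t f(s,y(s),u(s))\,ds$ for all $t\in[0,T)$, and let $$\mathcal P_{ad}=\Big\{(T,y,u)\in\mathcal P:\ \lim_{t\to T^-}|y(t)|=+\infty\Big\}.$$ If $\mathcal P_{ad}\neq\emptyset$, then the minimal blowup time problem (TI) has a solution: there exists $(\bar t,\bar y,\bar u)\in\mathcal P_{ad}$ such that $$\bar t=\inf_{(T,y,u)\in\mathcal P_{ad}}T .$$ -/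

import Mathlib

open MeasureTheory Set Filter Topology

namespace BlowupControl

/-- The state space `ℝⁿ` with its Euclidean norm. -/
abbrev State (n : ℕ) : Type := EuclideanSpace ℝ (Fin n)

/-- The right-hand side `f(t,y,u) = G(t,|y|) y/|y| + A(t) y + b(t,u)` of the controlled system.
Since `‖0‖⁻¹ • 0 = 0`, the first term is `0` at `y = 0`, which is its continuous extension
when `G(t,0) = 0`. -/
noncomputable def rhs {n : ℕ} {U : Type*} (G : ℝ → ℝ → ℝ)
    (A : ℝ → Matrix (Fin n) (Fin n) ℝ) (b : ℝ → U → State n)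
    (t : ℝ) (y : State n) (u : U) : State n :=
  G t ‖y‖ • (‖y‖⁻¹ • y) + Matrix.toEuclideanCLM (𝕜 := ℝ) (A t) y + b t u

/-- `G(t,r)` is measurable in `t ∈ [0,∞)` and continuously differentiable in `r ∈ [0,∞)`,
`G(t,0) = 0`, and `∂G/∂r` is bounded on `[0,M]²` for every `M > 0`
(at `r = 0` the derivative is the one-sided one). -/
structure AdmissibleG (G : ℝ → ℝ → ℝ) : Prop where
  measurable : ∀ r, 0 ≤ r → AEMeasurable (fun t => G t r) (volume.restrict (Ici 0))
  contDiff : ∀ t, 0 ≤ t → ContDiffOn ℝ 1 (G t) (Ici 0)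
  zero : ∀ t, 0 ≤ t → G t 0 = 0
  bounded : ∀ M : ℝ, 0 < M → ∃ C : ℝ, ∀ t ∈ Icc 0 M, ∀ r ∈ Icc 0 M,
    |derivWithin (G t) (Ici 0) r| ≤ C

/-- `A ∈ L^∞_loc([0,∞); ℝ^{n×n})`, the norm being the operator norm for the Euclidean norm. -/
structure AdmissibleA {n : ℕ} (A : ℝ → Matrix (Fin n) (Fin n) ℝ) : Prop where
  measurable : ∀ i j, AEMeasurable (fun t => A t i j) (volume.restrict (Ici 0))
  bounded : ∀ T : ℝ, 0 < T → ∃ C : ℝ, ∀ᵐ t ∂(volume.restrict (Icc 0 T)),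
    ‖Matrix.toEuclideanCLM (𝕜 := ℝ) (A t)‖ ≤ C

/-- `b` is a Carathéodory function with convex compact velocity sets `b(t,U)`, which are
locally (essentially) bounded in time, uniformly over `U`. -/
structure AdmissibleB {n : ℕ} {U : Type*} [TopologicalSpace U] (b : ℝ → U → State n) :
    Prop where
  measurable : ∀ u, AEMeasurable (fun t => b t u) (volume.restrict (Ici 0))
  continuous : ∀ t, 0 ≤ t → Continuous (b t)
  convex : ∀ t, 0 ≤ t → Convex ℝ (range (b t))
  compact : ∀ t, 0 ≤ t → IsCompact (range (b t))
  bounded : ∀ T : ℝ, 0 < T → ∃ C : ℝ, ∀ᵐ t ∂(volume.restrict (Icc 0 T)), ∀ u, ‖b t u‖ ≤ C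

/-- The set `𝒰` of controls: the (Lebesgue) measurable functions `[0,∞) → U`.  Values at
negative times are irrelevant. -/
def Controls (U : Type*) [MeasurableSpace U] : Set (ℝ → U) :=
  {u | AEMeasurable u (volume.restrict (Ici 0))}

/-- `y` is a solution on `[0,T)` of `y' = f(t,y,u(t))`, `y(0) = y₀`: it is continuous on
`[0,T)` and satisfies the integral equation there (with an integrable integrand). -/
def IsSolution {n : ℕ} {U : Type*} (G : ℝ → ℝ → ℝ)
    (A : ℝ → Matrix (Fin n) (Fin n) ℝ) (b : ℝ → U → State n) (y₀ : State n)
    (T : ℝ) (y : ℝ → State n) (u : ℝ → U) : Prop :=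
  ContinuousOn y (Ico 0 T) ∧
  ∀ t ∈ Ico 0 T,
    IntervalIntegrable (fun s => rhs G A b s (y s) (u s)) volume 0 t ∧
    y t = y₀ + ∫ s in (0 : ℝ)..t, rhs G A b s (y s) (u s)

/-- The set `𝒫` of feasible triples `(T, y(·), u(·))`. -/
def Feasible {n : ℕ} {U : Type*} [MeasurableSpace U] (G : ℝ → ℝ → ℝ)
    (A : ℝ → Matrix (Fin n) (Fin n) ℝ) (b : ℝ → U → State n) (y₀ : State n) :
    Set (ℝ × (ℝ → State n) × (ℝ → U)) :=
  {p | 0 < p.1 ∧ p.2.2 ∈ Controls U ∧ IsSolution G A b y₀ p.1 p.2.1 p.2.2}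

/-- The set `𝒫_ad` of admissible triples: the feasible ones with `|y(t)| → ∞` as `t → T⁻`. -/
def Admissible {n : ℕ} {U : Type*} [MeasurableSpace U] (G : ℝ → ℝ → ℝ)
    (A : ℝ → Matrix (Fin n) (Fin n) ℝ) (b : ℝ → U → State n) (y₀ : State n) :
    Set (ℝ × (ℝ → State n) × (ℝ → U)) :=
  {p | p ∈ Feasible G A b y₀ ∧ Tendsto (fun t => ‖p.2.1 t‖) (𝓝[<] p.1) atTop}

/-- Solutions of Problem (TI): admissible triples whose blowup time is the infimum of all
blowup times of admissible triples. -/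
def IsOptimalTI {n : ℕ} {U : Type*} [MeasurableSpace U] (G : ℝ → ℝ → ℝ)
    (A : ℝ → Matrix (Fin n) (Fin n) ℝ) (b : ℝ → U → State n) (y₀ : State n)
    (p : ℝ × (ℝ → State n) × (ℝ → U)) : Prop :=
  p ∈ Admissible G A b y₀ ∧ IsGLB (Prod.fst '' Admissible G A b y₀) p.1

end BlowupControl

/-!
Write `f = drift + b`, where `drift t y = G(t,|y|) y/|y| + A(t) y` is Lipschitz in `y` on bounded
sets, uniformly for `t` in bounded intervals.

**Compactness without a priori bounds.** Let `(Tₖ, yₖ, uₖ)` be admissible with `Tₖ` tending to the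
infimum along an ultrafilter `l`. It is not clear a priori that the `yₖ` are bounded on `[0, s]` for
every `s` below the infimum. Let `S` be the set of those `s` for which they are, with one bound for
`l`-almost all `k`, and let `τ` be its supremum. A solution of norm at most `R` at some time keeps
norm at most `R + 1` for a time that depends only on `R` (`exists_uniform_step`). So `S` has no
largest element, and the pointwise limit `z` of `yₖ` along `l`, which exists on `[0, τ)`, must blow
up at `τ`: a value `|z t| < R` with `t` close to `τ` would make the `yₖ` bounded beyond `τ`. A
trajectory that is bounded on `[0, s]` lives longer than `s`, so `τ ≤ lim Tₖ`. The ultrafilter makes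
subsequences, which could change `τ`, unnecessary.

**The limit is a trajectory.** On each `[0, s]` with `s < τ` the limit `z` is Lipschitz, hence the
integral of its derivative. For fixed `p`, passing to the limit in the integral equation over a
short interval `[t, s]`, where `yₖ` may be replaced by `z` up to an error `O(s - t)`, gives
`⟪p, z s - z t⟫ ≤ ∫ (⟪p, drift⟫ + sup_u ⟪p, b(r,u)⟫) + O((s - t)²)`; only pointwise convergence is
used. Lebesgue differentiation, for countably many `p`, and the separation theorem for the compact
convex set `b(t,U)` yield `z' - drift ∈ b(t,U)` almost everywhere (`ae_deriv_sub_drift_mem_range`).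

**The control.** A measurable `u` with `b(t,u(t)) = z' - drift` is provided by Filippov's lemma
(`exists_measurable_selection`). The Suslin space `U` is a continuous image of `ℕ → ℕ`, so that the
task is to find measurable zeros of a nonnegative Carathéodory function on `α × (ℕ → ℕ)`.
Continuity from below of the outer measure, applied one coordinate at a time, cuts `ℕ → ℕ` down to a
compact box in which zeros exist for all `t` outside a set of small measure. Approximate zeros taken
from a countable dense set are measurable in `t`, and so is a suitable cluster point of them
(`exists_measurable_mapClusterPt`).

With `τ` at most the infimum and `(τ, z, u)` admissible, `τ` equals the infimum.
-/

open scoped NNReal RealInnerProductSpace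

/-! ### Measurable selection -/

/-- A pointwise bounded sequence of measurable functions into `ℕ → ℕ` has a measurable selection of
its cluster points. The coordinates are chosen one after the other, each as the least value for
which the prefix so far is attained infinitely often. -/
theorem exists_measurable_mapClusterPt {α : Type*} [MeasurableSpace α] (d : ℕ → α → ℕ → ℕ)
    (hd : ∀ j i, Measurable fun t => d j t i)
    (hb : ∀ t i, ∃ n, ∀ᶠ j in atTop, d j t i ≤ n) :
    ∃ X : α → ℕ → ℕ, Measurable X ∧ ∀ t, MapClusterPt (X t) atTop fun j => d j t := by
  classical
  -- `Q t s`: infinitely many `d j t` start with `s`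
  set Q : α → List ℕ → Prop := fun t s =>
    ∃ᶠ j in atTop, ∀ i < s.length, d j t i = s.getD i 0 with hQ
  have hQm : ∀ s, MeasurableSet {t | Q t s} := by
    intro s
    have : {t | Q t s} =
        ⋂ N : ℕ, ⋃ j : ℕ, ⋃ _ : N ≤ j, ⋂ i : ℕ, ⋂ _ : i < s.length,
          (fun t => d j t i) ⁻¹' {s.getD i 0} := by
      ext t
      simp [hQ, frequently_atTop]
    rw [this]
    exact .iInter fun N => .iUnion fun j => .iUnion fun _ => .iInter fun i => .iInter fun _ =>
      hd j i (measurableSet_singleton _)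
  have hstep : ∀ t s, Q t s → ∃ a, Q t (s ++ [a]) := by
    intro t s h
    by_contra! hne
    obtain ⟨n, hn⟩ := hb t s.length
    have hall : ∀ᶠ j in atTop, ∀ a ∈ Iic n,
        ¬ ∀ i < (s ++ [a]).length, d j t i = (s ++ [a]).getD i 0 :=
      (finite_Iic n).eventually_all.2 fun a _ => not_frequently.1 (hne a)
    obtain ⟨j, hj, hjn, hja⟩ := (h.and_eventually (hn.and hall)).exists
    refine hja _ hjn fun i hi => ?_
    rcases Nat.lt_succ_iff_lt_or_eq.1 (by simpa using hi) with h' | rfl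
    · rw [hj i h', List.getD_append _ _ _ _ h']
    · simp
  -- the second alternative makes the search for `a` succeed for every `s`
  have hex : ∀ t s, ∃ a, Q t (s ++ [a]) ∨ ∀ a', ¬ Q t (s ++ [a']) := by
    intro t s
    by_cases h : ∃ a, Q t (s ++ [a])
    · exact h.imp fun a => Or.inl
    · exact ⟨0, Or.inr (not_exists.1 h)⟩
  set g : α → List ℕ → ℕ := fun t s => Nat.find (hex t s) with hg
  let _ : MeasurableSpace (List ℕ) := ⊤
  have : DiscreteMeasurableSpace (List ℕ) := ⟨fun _ => trivial⟩
  have hgm : Measurable fun p : α × List ℕ => g p.1 p.2 :=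
    measurable_from_prod_countable_left fun s =>
      measurable_find (fun t => hex t s) fun a => (hQm _).union <| by
        have : {t | ∀ a', ¬ Q t (s ++ [a'])} = ⋂ a', {t | Q t (s ++ [a'])}ᶜ := by
          ext t; simp
        change MeasurableSet {t | ∀ a', ¬ Q t (s ++ [a'])}
        rw [this]
        exact .iInter fun a' => (hQm _).compl
  have hgQ : ∀ t s, Q t s → Q t (s ++ [g t s]) := by
    intro t s h
    rcases Nat.find_spec (hex t s) with h' | h'
    · exact h'
    · obtain ⟨a, ha⟩ := hstep t s h
      exact absurd ha (h' a)
  -- `f j t` is the prefix of length `j` of the selected point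
  set f : ℕ → α → List ℕ := fun j => Nat.rec (fun _ => []) (fun _ F t => F t ++ [g t (F t)]) j
    with hf
  have hfm : ∀ j, Measurable (f j) := by
    intro j
    induction j with
    | zero => exact measurable_const
    | succ j ih =>
      exact (Measurable.of_discrete (f := fun p : List ℕ × ℕ => p.1 ++ [p.2])).comp
        (ih.prodMk (hgm.comp (measurable_id.prodMk ih)))
  have hlen : ∀ j t, (f j t).length = j := by
    intro j t
    induction j with
    | zero => rfl
    | succ j ih => simpa [hf] using! ih
  have hget : ∀ t i j, i < j → (f j t).getD i 0 = g t (f i t) := by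
    intro t i j hij
    induction j with
    | zero => omega
    | succ j ih =>
      change (f j t ++ [g t (f j t)]).getD i 0 = _
      rcases Nat.lt_succ_iff_lt_or_eq.1 hij with h | rfl
      · rw [List.getD_append _ _ _ _ (by rwa [hlen]), ih h]
      · rw [List.getD_append_right _ _ _ _ (by rw [hlen])]
        simp [hlen]
  have hQf : ∀ j t, Q t (f j t) := by
    intro j t
    induction j with
    | zero => exact Eventually.frequently (Eventually.of_forall fun j i hi => by simp [hf] at hi)
    | succ j ih => exact hgQ t _ ih
  refine ⟨fun t i => g t (f i t), measurable_pi_lambda _ fun i =>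
    hgm.comp (measurable_id.prodMk (hfm i)), fun t => ?_⟩
  rw [mapClusterPt_iff_frequently]
  intro s hs
  obtain ⟨_, ⟨x, j, rfl⟩, hx, hxs⟩ :=
    (PiNat.isTopologicalBasis_cylinders fun _ => ℕ).mem_nhds_iff.1 hs
  refine (hQf j t).mono fun k hk => hxs fun i hi => ?_
  rw [hk i (by rwa [hlen]), hget t i j hi]
  exact hx i hi

/-- A set-valued map into `ℕ → ℕ` can be restricted to a compact box at an arbitrarily small loss of
the outer measure of its domain, as long as only finitely many coordinates are constrained at a
time. The domains need not be measurable, since outer measures are continuous along arbitrary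
increasing sequences of sets. -/
theorem exists_bound_lt_measure {α : Type*} [MeasurableSpace α] (μ : Measure α)
    (S : α → Set (ℕ → ℕ)) {c : ENNReal} (hc : c < μ {t | (S t).Nonempty}) :
    ∃ n : ℕ → ℕ, ∀ j, c < μ {t | ∃ x ∈ S t, ∀ i < j, x i ≤ n i} := by
  have hstep : ∀ j (m : ℕ → ℕ), c < μ {t | ∃ x ∈ S t, ∀ i < j, x i ≤ m i} →
      ∃ a, c < μ {t | ∃ x ∈ S t, ∀ i < j + 1, x i ≤ Function.update m j a i} := by
    intro j m h
    have hU : {t | ∃ x ∈ S t, ∀ i < j, x i ≤ m i} =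
        ⋃ a, {t | ∃ x ∈ S t, ∀ i < j + 1, x i ≤ Function.update m j a i} := by
      ext t
      simp only [mem_ofPred_eq, mem_iUnion]
      constructor
      · rintro ⟨x, hx, hxm⟩
        refine ⟨x j, x, hx, fun i hi => ?_⟩
        rcases Nat.lt_succ_iff_lt_or_eq.1 hi with h | rfl
        · rw [Function.update_of_ne h.ne]
          exact hxm i h
        · simp
      · rintro ⟨a, x, hx, hxm⟩
        refine ⟨x, hx, fun i hi => ?_⟩
        have := hxm i (by omega)
        rwa [Function.update_of_ne hi.ne] at this
    have hmono : Monotone fun a : ℕ =>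
        {t | ∃ x ∈ S t, ∀ i < j + 1, x i ≤ Function.update m j a i} := by
      rintro a a' haa' t ⟨x, hx, hxm⟩
      exact ⟨x, hx, fun i hi => (hxm i hi).trans (update_le_update_iff.2
        ⟨haa', fun _ _ => le_rfl⟩ i)⟩
    rw [hU, hmono.measure_iUnion] at h
    exact lt_iSup_iff.1 h
  choose! a ha using hstep
  set m : ℕ → ℕ → ℕ := fun j => Nat.rec (fun _ => 0) (fun j m => Function.update m j (a j m)) j
    with hm
  have hms : ∀ j, m (j + 1) = Function.update (m j) j (a j (m j)) := fun j => rfl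
  have hmc : ∀ j, c < μ {t | ∃ x ∈ S t, ∀ i < j, x i ≤ m j i} := by
    intro j
    induction j with
    | zero => simpa [Set.Nonempty] using! hc
    | succ j ih => exact ha j _ ih
  have hstab : ∀ j i, i < j → m j i = m (i + 1) i := by
    intro j i hij
    induction j, hij using Nat.le_induction with
    | base => rfl
    | succ j hij ih => rw [hms, Function.update_of_ne (by omega), ih]
  refine ⟨fun i => m (i + 1) i, fun j => (hmc j).trans_le (measure_mono ?_)⟩
  rintro t ⟨x, hx, hxm⟩
  exact ⟨x, hx, fun i hi => (hxm i hi).trans_eq (hstab j i hi)⟩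

/-- Measurable zeros of a nonnegative Carathéodory function, on a set of measure close to full. The
zeros are cluster points of approximate zeros `d j t` from the dense sequence `D`, the first `j`
coordinates of which lie in a fixed box. -/
theorem exists_measurable_zero_on {α : Type*} [MeasurableSpace α] (μ : Measure α)
    [IsFiniteMeasure μ] {h : α → (ℕ → ℕ) → ℝ} {D : ℕ → ℕ → ℕ} (hD : DenseRange D)
    (hm : ∀ k, Measurable fun t => h t (D k)) (hc : ∀ t, Continuous (h t))
    (h0 : ∀ t x, 0 ≤ h t x) (hz : ∀ t, ∃ x, h t x = 0) {c : ENNReal} (hcμ : c < μ univ) :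
    ∃ F : Set α, MeasurableSet F ∧ c ≤ μ F ∧
      ∃ X : α → ℕ → ℕ, Measurable X ∧ ∀ t ∈ F, h t (X t) = 0 := by
  classical
  have hne : {t | {x | h t x = 0}.Nonempty} = univ := eq_univ_of_forall hz
  obtain ⟨n, hn⟩ := exists_bound_lt_measure μ (fun t => {x | h t x = 0}) (hne ▸ hcμ)
  set p : ℕ → α → ℕ → Prop := fun j t k =>
    h t (D k) < 1 / ((j : ℝ) + 1) ∧ ∀ i < j, D k i ≤ n i with hp
  have hpm : ∀ j k, MeasurableSet {t | p j t k} := fun j k =>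
    (measurableSet_lt (hm k) measurable_const).inter (.const _)
  set F : ℕ → Set α := fun j => {t | ∃ k, p j t k} with hF
  have hFm : ∀ j, MeasurableSet (F j) := by
    intro j
    have : F j = ⋃ k, {t | p j t k} := by ext t; simp [hF]
    exact this ▸ .iUnion (hpm j)
  have hanti : Antitone F := by
    rintro j j' hjj' t ⟨k, hk, hk'⟩
    exact ⟨k, hk.trans_le (one_div_le_one_div_of_le (by positivity) (by gcongr)),
      fun i hi => hk' i (hi.trans_le hjj')⟩
  have hle : ∀ j, c ≤ μ (F j) := by
    intro j
    refine (hn j).le.trans (measure_mono ?_)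
    rintro t ⟨x, hx, hxn⟩
    have hopen : IsOpen {y : ℕ → ℕ | h t y < 1 / ((j : ℝ) + 1) ∧ ∀ i < j, y i ≤ n i} := by
      refine (isOpen_lt (hc t) continuous_const).inter ?_
      have : {y : ℕ → ℕ | ∀ i < j, y i ≤ n i} = ⋂ i ∈ Iio j, {y | y i ≤ n i} := by
        ext y; simp
      change IsOpen {y : ℕ → ℕ | ∀ i < j, y i ≤ n i}
      rw [this]
      exact (finite_Iio j).isOpen_biInter fun i _ =>
        (isOpen_discrete (Iic (n i))).preimage (continuous_apply (A := fun _ : ℕ => ℕ) i)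
    obtain ⟨k, hk⟩ := hD.exists_mem_open hopen
      ⟨x, (show h t x = 0 from hx) ▸ by positivity, hxn⟩
    exact ⟨k, hk⟩
  refine ⟨⋂ j, F j, .iInter hFm, ge_of_tendsto'
    (tendsto_measure_iInter_atTop (fun j => (hFm j).nullMeasurableSet) hanti
      ⟨0, measure_ne_top _ _⟩) hle, ?_⟩
  have hex : ∀ j t, ∃ k, p j t k ∨ t ∉ F j := by
    intro j t
    by_cases ht : t ∈ F j
    · exact ht.imp fun k => Or.inl
    · exact ⟨0, Or.inr ht⟩
  set d : ℕ → α → ℕ → ℕ := fun j t => if t ∈ ⋂ j, F j then D (Nat.find (hex j t)) else 0 with hd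
  have hdm : ∀ j, Measurable (d j) := fun j =>
    Measurable.ite (.iInter hFm) ((measurable_from_top (f := D)).comp
      (measurable_find (hex j) fun k => (hpm j k).union (hFm j).compl)) measurable_const
  have hdp : ∀ t ∈ ⋂ j, F j, ∀ j, h t (d j t) < 1 / ((j : ℝ) + 1) ∧ ∀ i < j, d j t i ≤ n i := by
    intro t ht j
    have : d j t = D (Nat.find (hex j t)) := if_pos ht
    rw [this]
    exact (Nat.find_spec (hex j t)).resolve_right (not_not.2 (mem_iInter.1 ht j))
  obtain ⟨X, hX, hcl⟩ := exists_measurable_mapClusterPt d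
    (fun j i => (measurable_pi_apply i).comp (hdm j)) fun t i => by
      by_cases ht : t ∈ ⋂ j, F j
      · exact ⟨n i, (eventually_gt_atTop i).mono fun j hj => (hdp t ht j).2 i hj⟩
      · exact ⟨0, Eventually.of_forall fun j => by simp only [hd, if_neg ht]; rfl⟩
  refine ⟨X, hX, fun t ht => ?_⟩
  have h1 : Tendsto (fun j => h t (d j t)) atTop (𝓝 0) :=
    squeeze_zero (fun j => h0 t _) (fun j => (hdp t ht j).1.le)
      tendsto_one_div_add_atTop_nhds_zero_nat
  have h2 : MapClusterPt (h t (X t)) atTop fun j => h t (d j t) :=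
    (hcl t).tendsto_comp (hc t).continuousAt
  have : NeBot (𝓝 (h t (X t)) ⊓ 𝓝 0) := ClusterPt.mono h2 h1
  exact eq_of_nhds_neBot this

theorem exists_measurable_zero {α : Type*} [MeasurableSpace α] (μ : Measure α)
    [IsFiniteMeasure μ] {h : α → (ℕ → ℕ) → ℝ} {D : ℕ → ℕ → ℕ} (hD : DenseRange D)
    (hm : ∀ k, Measurable fun t => h t (D k)) (hc : ∀ t, Continuous (h t))
    (h0 : ∀ t x, 0 ≤ h t x) (hz : ∀ t, ∃ x, h t x = 0) :
    ∃ X : α → ℕ → ℕ, Measurable X ∧ ∀ᵐ t ∂μ, h t (X t) = 0 := by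
  rcases eq_zero_or_pos (μ univ) with hμ | hμ
  · refine ⟨0, measurable_const, ?_⟩
    simp [Measure.measure_univ_eq_zero.1 hμ]
  obtain ⟨c, -, hcμ, hct⟩ := exists_seq_strictMono_tendsto' hμ
  choose F hFm hcF X hXm hX using fun k =>
    exists_measurable_zero_on μ hD hm hc h0 hz (hcμ k).2
  obtain ⟨Y, hY, hYX⟩ := exists_measurable_piecewise (disjointed F)
    (fun k => .disjointed hFm k) X hXm fun i j hij t ht =>
      ((disjoint_disjointed F hij).le_bot ht).elim
  refine ⟨Y, hY, ?_⟩
  have hfull : ∀ᵐ t ∂μ, t ∈ ⋃ k, F k := by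
    refine (ae_mem_iff_measure_eq (MeasurableSet.iUnion hFm).nullMeasurableSet).2
      (le_antisymm (measure_mono (subset_univ _)) (le_of_tendsto' hct fun k => ?_))
    exact (hcF k).trans (measure_mono (subset_iUnion F k))
  filter_upwards [hfull] with t ht
  rw [← iUnion_disjointed] at ht
  obtain ⟨k, hk⟩ := mem_iUnion.1 ht
  rw [hYX k hk]
  exact hX k t (disjointed_subset F k hk)

/-- **Filippov's lemma** for a Carathéodory map `b` on a Suslin space: a measurable `v` with
`v t ∈ range (b t)` has the form `v t = b t (u t)` for a measurable `u`, almost everywhere. The base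
point `u₀` only excludes the case of empty `U`. -/
theorem exists_measurable_selection {α U E : Type*} [MeasurableSpace α] (μ : Measure α)
    [IsFiniteMeasure μ] [TopologicalSpace U] [MeasurableSpace U] [BorelSpace U]
    [MetricSpace E] [MeasurableSpace E] [BorelSpace E] [SecondCountableTopology E]
    (hU : AnalyticSet (univ : Set U)) (u₀ : U) {b : α → U → E} {v : α → E}
    (hbm : ∀ u, AEMeasurable (fun t => b t u) μ) (hbc : ∀ᵐ t ∂μ, Continuous (b t))
    (hv : AEMeasurable v μ) (hvb : ∀ᵐ t ∂μ, v t ∈ range (b t)) :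
    ∃ u : α → U, Measurable u ∧ ∀ᵐ t ∂μ, b t (u t) = v t := by
  classical
  rw [AnalyticSet] at hU
  rcases hU with hU | ⟨φ, hφ, hφU⟩
  · exact absurd (mem_univ u₀) (hU ▸ notMem_empty u₀)
  set D : ℕ → ℕ → ℕ := TopologicalSpace.denseSeq (ℕ → ℕ)
  have hhm : ∀ k, AEMeasurable (fun t => dist (b t (φ (D k))) (v t)) μ := fun k =>
    (hbm _).dist hv
  have hgood : ∀ᵐ t ∂μ, Continuous (b t) ∧ v t ∈ range (b t) ∧
      ∀ k, dist (b t (φ (D k))) (v t) = (hhm k).mk _ t := by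
    filter_upwards [hbc, hvb, ae_all_iff.2 fun k => (hhm k).ae_eq_mk] with t h1 h2 h3
    exact ⟨h1, h2, h3⟩
  -- off a measurable null set `N` all the regularity holds everywhere, and on `N` the function
  -- whose zeros are sought is replaced by `0`
  obtain ⟨N, hNsub, hNm, hN⟩ := exists_measurable_superset_of_null hgood
  have hgood' : ∀ t ∉ N, Continuous (b t) ∧ v t ∈ range (b t) ∧
      ∀ k, dist (b t (φ (D k))) (v t) = (hhm k).mk _ t := by
    intro t ht
    by_contra hcon
    exact ht (hNsub hcon)
  obtain ⟨X, hX, hXz⟩ := exists_measurable_zero μ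
    (h := fun t x => if t ∈ N then 0 else dist (b t (φ x)) (v t))
    (TopologicalSpace.denseRange_denseSeq (ℕ → ℕ))
    (fun k => by
      have : (fun t => if t ∈ N then 0 else dist (b t (φ (D k))) (v t)) =
          fun t => if t ∈ N then 0 else (hhm k).mk _ t := by
        ext t
        split_ifs with ht
        · rfl
        · exact (hgood' t ht).2.2 k
      change Measurable (fun t => if t ∈ N then 0 else dist (b t (φ (D k))) (v t))
      rw [this]
      exact Measurable.ite hNm measurable_const (hhm k).measurable_mk)
    (fun t => by
      by_cases ht : t ∈ N
      · simpa [ht] using continuous_const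
      · simpa [ht] using ((hgood' t ht).1.comp hφ).dist continuous_const)
    (fun t x => by split_ifs <;> positivity)
    (fun t => by
      by_cases ht : t ∈ N
      · simp [ht]
      · obtain ⟨u, hu⟩ := (hgood' t ht).2.1
        obtain ⟨x, rfl⟩ : u ∈ range φ := hφU ▸ mem_univ u
        exact ⟨x, by simp [ht, hu]⟩)
  refine ⟨fun t => φ (X t), hφ.measurable.comp hX, ?_⟩
  filter_upwards [hXz, measure_eq_zero_iff_ae_notMem.1 hN] with t ht htN
  simpa [htN] using ht

/-! ### Lipschitz curves and Carathéodory compositions -/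

/-- The fundamental theorem of calculus for Lipschitz curves in a finite-dimensional space. -/
theorem LipschitzOnWith.intervalIntegrable_deriv_and_integral_eq {E : Type*} [NormedAddCommGroup E]
    [NormedSpace ℝ E] [FiniteDimensional ℝ E] {K : ℝ≥0} {y : ℝ → E} {a b : ℝ} (hab : a ≤ b)
    (hy : LipschitzOnWith K y (Icc a b)) :
    IntervalIntegrable (deriv y) volume a b ∧ ∫ x in a..b, deriv y x = y b - y a := by
  have : CompleteSpace E := FiniteDimensional.complete ℝ E
  have hne : ∀ c : ℝ, ∀ᵐ x : ℝ, x ≠ c := fun c => by simp [ae_iff, measure_singleton]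
  have hnhds : ∀ᵐ x : ℝ, x ∈ Icc a b → Icc a b ∈ 𝓝 x := by
    filter_upwards [hne a, hne b] with x h1 h2 hx
    exact Icc_mem_nhds (lt_of_le_of_ne hx.1 h1.symm) (lt_of_le_of_ne hx.2 h2)
  have hbound : ∀ᵐ x : ℝ, x ∈ Icc a b → ‖deriv y x‖ ≤ K := by
    filter_upwards [hnhds] with x hx hxab
    exact norm_deriv_le_of_lipschitzOn (hx hxab) hy
  have hint : IntervalIntegrable (deriv y) volume a b := by
    rw [intervalIntegrable_iff_integrableOn_Icc_of_le hab]
    refine Measure.integrableOn_of_bounded (M := K) (by simp) (aestronglyMeasurable_deriv _ _) ?_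
    exact (ae_restrict_iff' measurableSet_Icc).2 hbound
  refine ⟨hint, ?_⟩
  have hsub : ∀ x ∈ Icc a b, ∀ z ∈ Icc a b, uIoc x z ⊆ Icc a b := fun x hx z hz =>
    uIoc_subset_uIcc.trans (uIcc_subset_Icc hx hz)
  have hii : ∀ x ∈ Icc a b, ∀ z ∈ Icc a b, IntervalIntegrable (deriv y) volume x z :=
    fun x hx z hz => hint.mono_set (by rw [uIcc_of_le hab]; exact uIcc_subset_Icc hx hz)
  have hF : LipschitzOnWith K (fun x => ∫ t in a..x, deriv y t) (Icc a b) := by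
    refine LipschitzOnWith.of_dist_le_mul fun x hx z hz => ?_
    have ha : a ∈ Icc a b := left_mem_Icc.2 hab
    rw [dist_eq_norm, intervalIntegral.integral_interval_sub_left (hii a ha x hx) (hii a ha z hz),
      Real.dist_eq]
    exact intervalIntegral.norm_integral_le_of_norm_le_const_ae
      (hbound.mono fun t ht htm => ht (hsub z hz x hx htm))
  have hg := (uIcc_of_le hab ▸ hy.sub hF).absolutelyContinuousOnInterval
  obtain ⟨C, hC⟩ := hg.const_of_ae_hasDerivAt_zero (by
    filter_upwards [hy.ae_differentiableWithinAt_of_mem (μ := volume), hnhds,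
      hint.ae_hasDerivAt_integral] with x h1 h2 h3 hx
    have hx' : x ∈ Icc a b := uIcc_of_le hab ▸ hx
    have := ((h1 hx').differentiableAt (h2 hx')).hasDerivAt.sub (h3 hx a (by simp))
    simpa using! this)
  have e := (hC b (by simp)).trans (hC a (by simp)).symm
  simp only [intervalIntegral.integral_same, sub_zero] at e
  rw [← e]; abel

/-- The composition of a Carathéodory function with a measurable function is measurable. -/
theorem aemeasurable_comp_of_ae_continuous {α X E : Type*} [MeasurableSpace α] {μ : Measure α}
    [TopologicalSpace X] [TopologicalSpace E] [TopologicalSpace.PseudoMetrizableSpace E]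
    [MeasurableSpace E] [BorelSpace E] {g : α → X → E}
    (hg : ∀ x, AEMeasurable (fun t => g t x) μ) (hc : ∀ᵐ t ∂μ, Continuous (g t))
    {y : α → X} (hy : AEStronglyMeasurable y μ) : AEMeasurable (fun t => g t (y t)) μ := by
  have hs : ∀ f : SimpleFunc α X, AEMeasurable (fun t => g t (f t)) μ := by
    intro f
    have hU : (⋃ c : f.range, f ⁻¹' {(c : X)}) = univ :=
      eq_univ_of_forall fun t => mem_iUnion.2 ⟨⟨f t, f.mem_range_self t⟩, rfl⟩
    rw [← Measure.restrict_univ (μ := μ), ← hU, aemeasurable_iUnion_iff]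
    intro c
    refine ((hg c).mono_measure Measure.restrict_le_self).congr ?_
    refine (ae_restrict_iff' (f.measurableSet_fiber c)).2 (.of_forall fun t ht => ?_)
    simp only [show f t = (c : X) from ht]
  have h1 : AEMeasurable (fun t => g t (hy.mk y t)) μ := by
    refine aemeasurable_of_tendsto_metrizable_ae atTop
      (fun k => hs (hy.stronglyMeasurable_mk.approx k)) ?_
    filter_upwards [hc] with t ht
    exact (ht.tendsto _).comp (hy.stronglyMeasurable_mk.tendsto_approx t)
  refine h1.congr ?_
  filter_upwards [hy.ae_eq_mk] with t ht
  rw [ht]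

namespace BlowupControl

variable {n : ℕ} {U : Type*}

/-! ### The drift and local growth of solutions -/

/-- The uncontrolled part `G(t,|y|) y/|y| + A(t) y` of the right-hand side, with the first term read
as `0` at `y = 0` as in `rhs`. -/
noncomputable def drift (G : ℝ → ℝ → ℝ) (A : ℝ → Matrix (Fin n) (Fin n) ℝ) (t : ℝ)
    (y : State n) : State n :=
  G t ‖y‖ • (‖y‖⁻¹ • y) + Matrix.toEuclideanCLM (𝕜 := ℝ) (A t) y

theorem rhs_eq_drift_add (G : ℝ → ℝ → ℝ) (A : ℝ → Matrix (Fin n) (Fin n) ℝ)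
    (b : ℝ → U → State n) (t : ℝ) (y : State n) (u : U) :
    rhs G A b t y u = drift G A t y + b t u := rfl

/-- The radial field `y ↦ γ(|y|) y/|y|` is `3C`-Lipschitz on a ball if `γ` is `C`-Lipschitz and
vanishes at `0`. -/
theorem norm_radial_sub_le {E : Type*} [NormedAddCommGroup E] [NormedSpace ℝ E] {γ : ℝ → ℝ}
    {C M : ℝ} (h0 : γ 0 = 0)
    (hγ : ∀ r ∈ Icc 0 M, ∀ s ∈ Icc 0 M, |γ r - γ s| ≤ C * |r - s|) {y z : E}
    (hy : ‖y‖ ≤ M) (hz : ‖z‖ ≤ M) :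
    ‖γ ‖y‖ • (‖y‖⁻¹ • y) - γ ‖z‖ • (‖z‖⁻¹ • z)‖ ≤ 3 * C * ‖y - z‖ := by
  have hM : 0 ≤ M := (norm_nonneg y).trans hy
  have hγ0 : ∀ w : E, ‖w‖ ≤ M → |γ ‖w‖| ≤ C * ‖w‖ := fun w hw => by
    simpa [h0] using hγ ‖w‖ ⟨norm_nonneg w, hw⟩ 0 ⟨le_rfl, hM⟩
  have hunit : ∀ w : E, ‖‖w‖⁻¹ • w‖ ≤ 1 := fun w => by
    rw [norm_smul, norm_inv, norm_norm]
    exact inv_mul_le_one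
  have habs : |‖y‖ - ‖z‖| ≤ ‖y - z‖ := abs_norm_sub_norm_le y z
  have h1 : |γ ‖y‖ - γ ‖z‖| ≤ C * |‖y‖ - ‖z‖| :=
    hγ _ ⟨norm_nonneg y, hy⟩ _ ⟨norm_nonneg z, hz⟩
  rcases eq_or_ne y z with rfl | hyz
  · simp
  have hpos : 0 < ‖y - z‖ := norm_pos_iff.2 (sub_ne_zero.2 hyz)
  have hC : 0 ≤ C := by
    rcases eq_or_ne y 0 with rfl | hy0
    · have := (abs_nonneg _).trans (hγ0 z hz)
      exact nonneg_of_mul_nonneg_left this (by simpa using hpos)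
    · exact nonneg_of_mul_nonneg_left ((abs_nonneg _).trans (hγ0 y hy)) (norm_pos_iff.2 hy0)
  rcases eq_or_ne y 0 with rfl | hy0
  · have h2 : ‖γ ‖z‖ • (‖z‖⁻¹ • z)‖ ≤ C * ‖z‖ * 1 := by
      rw [norm_smul]
      exact mul_le_mul (hγ0 z hz) (hunit z) (norm_nonneg _) (by positivity)
    simp only [smul_zero, zero_sub, norm_neg]
    nlinarith [norm_nonneg z]
  have hy' : ‖y‖ ≠ 0 := norm_ne_zero_iff.2 hy0
  -- the radii contribute `C ‖y - z‖` and the directions, weighted by `|γ ‖z‖| ≤ C ‖z‖`, twice as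
  -- much
  have h3 : γ ‖y‖ • (‖y‖⁻¹ • y) - γ ‖z‖ • (‖z‖⁻¹ • z) =
      (γ ‖y‖ - γ ‖z‖) • (‖y‖⁻¹ • y) + γ ‖z‖ • (‖y‖⁻¹ • y - ‖z‖⁻¹ • z) := by
    module
  have h4 : ‖z‖ * ‖‖y‖⁻¹ • y - ‖z‖⁻¹ • z‖ ≤ 2 * ‖y - z‖ := by
    rcases eq_or_ne z 0 with rfl | hz0
    · simp
    have hz' : ‖z‖ ≠ 0 := norm_ne_zero_iff.2 hz0
    have e : ‖z‖ • (‖y‖⁻¹ • y - ‖z‖⁻¹ • z) = (‖z‖ - ‖y‖) • (‖y‖⁻¹ • y) + (y - z) := by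
      rw [smul_sub, sub_smul, smul_inv_smul₀ hz', smul_inv_smul₀ hy']
      abel
    calc ‖z‖ * ‖‖y‖⁻¹ • y - ‖z‖⁻¹ • z‖ = ‖‖z‖ • (‖y‖⁻¹ • y - ‖z‖⁻¹ • z)‖ := by
          rw [norm_smul, norm_norm]
      _ ≤ |‖z‖ - ‖y‖| * 1 + ‖y - z‖ := by
          rw [e]
          refine (norm_add_le _ _).trans (add_le_add_left ?_ _)
          rw [norm_smul, Real.norm_eq_abs]
          exact mul_le_mul_of_nonneg_left (hunit y) (abs_nonneg _)
      _ ≤ 2 * ‖y - z‖ := by rw [abs_sub_comm]; linarith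
  calc _ ≤ |γ ‖y‖ - γ ‖z‖| * 1 + |γ ‖z‖| * ‖‖y‖⁻¹ • y - ‖z‖⁻¹ • z‖ := by
        rw [h3]
        refine (norm_add_le _ _).trans (add_le_add ?_ (norm_smul _ _).le)
        rw [norm_smul, Real.norm_eq_abs]
        exact mul_le_mul_of_nonneg_left (hunit y) (abs_nonneg _)
    _ ≤ C * ‖y - z‖ + C * (2 * ‖y - z‖) := by
        refine add_le_add ?_ ?_
        · rw [mul_one]
          exact h1.trans (mul_le_mul_of_nonneg_left habs hC)
        · refine (mul_le_mul_of_nonneg_right (hγ0 z hz) (norm_nonneg _)).trans ?_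
          rw [mul_assoc]
          exact mul_le_mul_of_nonneg_left h4 hC
    _ = 3 * C * ‖y - z‖ := by ring

theorem AdmissibleG.exists_lipschitz {G : ℝ → ℝ → ℝ} (hG : AdmissibleG G) {M : ℝ} (hM : 0 < M) :
    ∃ C, 0 ≤ C ∧ ∀ t ∈ Icc 0 M, ∀ r ∈ Icc 0 M, ∀ s ∈ Icc 0 M, |G t r - G t s| ≤ C * |r - s| := by
  obtain ⟨C, hC⟩ := hG.bounded M hM
  have h0 : (0 : ℝ) ∈ Icc 0 M := ⟨le_rfl, hM.le⟩
  refine ⟨C, (abs_nonneg _).trans (hC 0 h0 0 h0), fun t ht r hr s hs => ?_⟩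
  refine Convex.norm_image_sub_le_of_norm_hasDerivWithin_le (s := Icc 0 M)
    (f' := derivWithin (G t) (Ici 0)) (fun x hx => ?_) (fun x hx => hC t ht x hx)
    (convex_Icc 0 M) hs hr
  exact (((hG.contDiff t ht.1).differentiableOn one_ne_zero x hx.1).hasDerivWithinAt).mono
    Icc_subset_Ici_self

section drift

variable {G : ℝ → ℝ → ℝ} {A : ℝ → Matrix (Fin n) (Fin n) ℝ}

theorem drift_zero (t : ℝ) : drift G A t 0 = 0 := by simp [drift]

theorem continuous_drift (hG : AdmissibleG G) {t : ℝ} (ht : 0 ≤ t) :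
    Continuous (drift G A t) := by
  refine Continuous.add ?_ (ContinuousLinearMap.continuous _)
  refine continuous_iff_continuousAt.2 fun y => ?_
  have hM : 0 < t + ‖y‖ + 1 := by positivity
  obtain ⟨C, hC0, hC⟩ := hG.exists_lipschitz hM
  have hlip : LipschitzOnWith (3 * C).toNNReal (fun y : State n => G t ‖y‖ • (‖y‖⁻¹ • y))
      (Metric.closedBall 0 (t + ‖y‖ + 1)) := by
    refine LipschitzOnWith.of_dist_le_mul fun x hx z hz => ?_
    rw [dist_eq_norm, dist_eq_norm, Real.coe_toNNReal _ (by positivity)]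
    exact norm_radial_sub_le (hG.zero t ht) (hC t ⟨ht, by linarith [norm_nonneg y]⟩)
      (by simpa using hx) (by simpa using hz)
  exact hlip.continuousOn.continuousAt (Metric.closedBall_mem_nhds_of_mem (by
    simp only [Metric.mem_ball, dist_zero_right]; linarith))

theorem aemeasurable_drift (hG : AdmissibleG G) (hA : AdmissibleA A) (y : State n) :
    AEMeasurable (fun t => drift G A t y) (volume.restrict (Ici 0)) := by
  refine AEMeasurable.add ((hG.measurable _ (norm_nonneg y)).smul_const _) ?_
  have : (fun t => Matrix.toEuclideanCLM (𝕜 := ℝ) (A t) y) =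
      fun t => WithLp.toLp 2 (fun i => ∑ j, A t i j * y j) := by
    ext t i
    simp [Matrix.ofLp_toEuclideanCLM, Matrix.mulVec, dotProduct]
  rw [this]
  refine (WithLp.measurable_toLp 2 _).comp_aemeasurable (aemeasurable_pi_lambda _ fun i => ?_)
  exact Finset.aemeasurable_fun_sum _ fun j _ => (hA.measurable i j).mul_const _

theorem exists_lipschitz_drift (hG : AdmissibleG G) (hA : AdmissibleA A) {M : ℝ} (hM : 0 < M) :
    ∃ L, 0 ≤ L ∧ ∀ᵐ t, t ∈ Icc 0 M → ∀ y z : State n, ‖y‖ ≤ M → ‖z‖ ≤ M →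
      ‖drift G A t y - drift G A t z‖ ≤ L * ‖y - z‖ := by
  obtain ⟨C, hC0, hC⟩ := hG.exists_lipschitz hM
  obtain ⟨C', hC'⟩ := hA.bounded M hM
  refine ⟨3 * C + max C' 0, by positivity, ?_⟩
  filter_upwards [(ae_restrict_iff' measurableSet_Icc).1 hC'] with t ht htM y z hy hz
  have e : drift G A t y - drift G A t z =
      (G t ‖y‖ • (‖y‖⁻¹ • y) - G t ‖z‖ • (‖z‖⁻¹ • z)) +
        Matrix.toEuclideanCLM (𝕜 := ℝ) (A t) (y - z) := by
    rw [map_sub]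
    simp only [drift]
    abel
  rw [e, add_mul]
  refine (norm_add_le _ _).trans (add_le_add
    (norm_radial_sub_le (hG.zero t htM.1) (hC t htM) hy hz) ?_)
  exact (ContinuousLinearMap.le_opNorm _ _).trans
    (mul_le_mul_of_nonneg_right ((ht htM).trans (le_max_left _ _)) (norm_nonneg _))

theorem exists_bound_rhs [TopologicalSpace U] {b : ℝ → U → State n} (hG : AdmissibleG G)
    (hA : AdmissibleA A) (hb : AdmissibleB b) {M : ℝ} (hM : 0 < M) :
    ∃ K, 0 ≤ K ∧ ∀ᵐ t, t ∈ Icc 0 M → ∀ y : State n, ‖y‖ ≤ M → ∀ u, ‖rhs G A b t y u‖ ≤ K := by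
  obtain ⟨L, hL0, hL⟩ := exists_lipschitz_drift hG hA hM
  obtain ⟨C, hC⟩ := hb.bounded M hM
  refine ⟨L * M + max C 0, by positivity, ?_⟩
  filter_upwards [hL, (ae_restrict_iff' measurableSet_Icc).1 hC] with t h1 h2 htM y hy u
  rw [rhs_eq_drift_add]
  refine (norm_add_le _ _).trans (add_le_add ?_ ((h2 htM u).trans (le_max_left _ _)))
  have := h1 htM y 0 hy (by simpa using hM.le)
  rw [drift_zero, sub_zero, sub_zero] at this
  exact this.trans (mul_le_mul_of_nonneg_left hy hL0)

end drift

theorem IsSolution.sub_eq_integral {G : ℝ → ℝ → ℝ} {A : ℝ → Matrix (Fin n) (Fin n) ℝ}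
    {b : ℝ → U → State n} {y₀ : State n} {T : ℝ} {y : ℝ → State n} {u : ℝ → U}
    (h : IsSolution G A b y₀ T y u) {s t : ℝ} (hs : 0 ≤ s) (hst : s ≤ t) (ht : t < T) :
    IntervalIntegrable (fun r => rhs G A b r (y r) (u r)) volume s t ∧
    y t - y s = ∫ r in s..t, rhs G A b r (y r) (u r) := by
  obtain ⟨h1, h2⟩ := h.2 t ⟨hs.trans hst, ht⟩
  obtain ⟨h3, h4⟩ := h.2 s ⟨hs, hst.trans_lt ht⟩
  refine ⟨h3.symm.trans h1, ?_⟩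
  rw [h2, h4, add_sub_add_left_eq_sub, intervalIntegral.integral_interval_sub_left h1 h3]

theorem IsSolution.norm_sub_le {G : ℝ → ℝ → ℝ} {A : ℝ → Matrix (Fin n) (Fin n) ℝ}
    {b : ℝ → U → State n} {y₀ : State n} {T : ℝ} {y : ℝ → State n} {u : ℝ → U}
    (h : IsSolution G A b y₀ T y u) {M K : ℝ}
    (hK : ∀ᵐ t, t ∈ Icc 0 M → ∀ y : State n, ‖y‖ ≤ M → ∀ u, ‖rhs G A b t y u‖ ≤ K)
    {s t : ℝ} (hs : 0 ≤ s) (hst : s ≤ t) (ht : t < T) (htM : t ≤ M)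
    (hy : ∀ r ∈ Ico s t, ‖y r‖ ≤ M) : ‖y t - y s‖ ≤ K * (t - s) := by
  rw [(h.sub_eq_integral hs hst ht).2, ← abs_of_nonneg (sub_nonneg.2 hst)]
  refine intervalIntegral.norm_integral_le_of_norm_le_const_ae ?_
  have hne : ∀ᵐ r : ℝ, r ≠ t := by simp [ae_iff, measure_singleton]
  filter_upwards [hK, hne] with r hr hrt hrm
  rw [uIoc_of_le hst] at hrm
  exact hr ⟨hs.trans hrm.1.le, hrm.2.trans htM⟩ _ (hy r ⟨hrm.1.le, lt_of_le_of_ne hrm.2 hrt⟩) _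

/-- A solution of norm at most `R` at a time before `τ` has norm at most `R + 1` for a further time
`δ` that depends only on `R` and `τ`, or until its lifetime `T` ends. -/
theorem exists_uniform_step [TopologicalSpace U] {G : ℝ → ℝ → ℝ}
    {A : ℝ → Matrix (Fin n) (Fin n) ℝ} {b : ℝ → U → State n} (hG : AdmissibleG G)
    (hA : AdmissibleA A) (hb : AdmissibleB b) (R τ : ℝ) :
    ∃ δ, 0 < δ ∧ ∀ (y₀ : State n) (T : ℝ) (y : ℝ → State n) (u : ℝ → U),
      IsSolution G A b y₀ T y u → ∀ s, 0 ≤ s → s ≤ τ → ‖y s‖ ≤ R →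
      ∀ t, s ≤ t → t ≤ s + δ → t < T → ‖y t‖ ≤ R + 1 := by
  set M := max (R + 1) (max τ 0 + 1) with hM
  have hM0 : 0 < M := lt_max_of_lt_right (by positivity)
  obtain ⟨K, hK0, hK⟩ := exists_bound_rhs hG hA hb hM0
  have hδ : 0 < min 1 (1 / (K + 1)) := by positivity
  refine ⟨min 1 (1 / (K + 1)), hδ, fun y₀ T y u h s hs hsτ hys t hst htδ htT => ?_⟩
  by_contra! hcon
  have hcont : ContinuousOn (fun r => ‖y r‖) (Icc s t) :=
    (h.1.mono fun r hr => ⟨hs.trans hr.1, hr.2.trans_lt htT⟩).norm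
  have hcl : IsCompact (Icc s t ∩ (fun r => ‖y r‖) ⁻¹' Ici (R + 1)) :=
    isCompact_Icc.of_isClosed_subset
      (hcont.preimage_isClosed_of_isClosed isClosed_Icc isClosed_Ici) inter_subset_left
  -- `q` is the first time at which the norm reaches `R + 1`
  obtain ⟨q, ⟨hq, hqR⟩, hqmin⟩ := hcl.exists_isLeast ⟨t, ⟨hst, le_rfl⟩, hcon.le⟩
  have hqR' : R + 1 ≤ ‖y q‖ := hqR
  have hle : q ≤ s + min 1 (1 / (K + 1)) := hq.2.trans htδ
  have hqs : q - s ≤ 1 / (K + 1) := by linarith [min_le_right 1 (1 / (K + 1))]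
  have hqM : q ≤ M := by
    have := min_le_left 1 (1 / (K + 1))
    have h1 : max τ 0 + 1 ≤ M := le_max_right _ _
    linarith [le_max_left τ 0]
  have key := h.norm_sub_le hK hs hq.1 (hq.2.trans_lt htT) hqM fun r hr => by
    by_contra! hr'
    have : R + 1 ≤ ‖y r‖ := (le_max_left _ _).trans hr'.le
    exact hr.2.not_ge (hqmin ⟨⟨hr.1, hr.2.le.trans hq.2⟩, this⟩)
  have h1 : ‖y q‖ - ‖y s‖ ≤ ‖y q - y s‖ := norm_sub_norm_le _ _
  have h2 : K * (q - s) ≤ K * (1 / (K + 1)) := mul_le_mul_of_nonneg_left hqs hK0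
  have h3 : K * (1 / (K + 1)) < 1 := by
    rw [mul_one_div, div_lt_one (by positivity)]; linarith
  linarith

end BlowupControl

/-! ### The differential inclusion for limits of solutions -/

/-- A point that no half-space with normal in the dense sequence `D` separates from points `c i` of
a compact convex set belongs to that set: boundedness of the set lets a separating functional be
perturbed into `D`. -/
theorem mem_of_forall_inner_le_iSup {E : Type*} [NormedAddCommGroup E] [InnerProductSpace ℝ E]
    [CompleteSpace E] {S : Set E} (hS : Convex ℝ S) (hc : IsCompact S) {D : ℕ → E}
    (hD : DenseRange D) {c : ℕ → E} (hcS : ∀ i, c i ∈ S) {w : E}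
    (hw : ∀ k, ⟪D k, w⟫ ≤ ⨆ i, ⟪D k, c i⟫) : w ∈ S := by
  by_contra hwS
  obtain ⟨f, r, hfS, hfw⟩ := geometric_hahn_banach_closed_point hS hc.isClosed hwS
  obtain ⟨p, rfl⟩ := (InnerProductSpace.toDual ℝ E).surjective f
  simp only [InnerProductSpace.toDual_apply_apply] at hfS hfw
  obtain ⟨R, hR⟩ := hc.isBounded.exists_norm_le
  have hopen : IsOpen {q : E | ‖q - p‖ * (R + ‖w‖) < ⟪p, w⟫ - r} :=
    isOpen_lt (by fun_prop) continuous_const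
  obtain ⟨k, hk⟩ := hD.exists_mem_open hopen ⟨p, by simpa using hfw⟩
  have h1 : ⟪D k, w⟫ ≤ r + ‖D k - p‖ * R := by
    refine (hw k).trans (ciSup_le fun i => ?_)
    have e : ⟪D k, c i⟫ = ⟪p, c i⟫ + ⟪D k - p, c i⟫ := by rw [inner_sub_left]; ring
    have h2 : ⟪D k - p, c i⟫ ≤ ‖D k - p‖ * R := (real_inner_le_norm _ _).trans
      (mul_le_mul_of_nonneg_left (hR _ (hcS i)) (norm_nonneg _))
    linarith [hfS _ (hcS i)]
  have h3 : ⟪p, w⟫ - ‖D k - p‖ * ‖w‖ ≤ ⟪D k, w⟫ := by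
    have e : ⟪D k, w⟫ = ⟪p, w⟫ + ⟪D k - p, w⟫ := by rw [inner_sub_left]; ring
    linarith [neg_le_of_abs_le (abs_real_inner_le_norm (D k - p) w)]
  have hk' : ‖D k - p‖ * (R + ‖w‖) < ⟪p, w⟫ - r := hk
  linarith

theorem HasDerivAt.nonpos_of_sub_le_sq {F : ℝ → ℝ} {F' t τ c : ℝ} (hF : HasDerivAt F F' t)
    (htτ : t < τ) (h : ∀ s, t ≤ s → s ≤ τ → F s - F t ≤ c * (s - t) ^ 2) : F' ≤ 0 := by
  have h1 : Tendsto (slope F t) (𝓝[>] t) (𝓝 F') :=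
    (hasDerivAt_iff_tendsto_slope.1 hF).mono_left (nhdsWithin_mono _ fun s hs => ne_of_gt hs)
  have h2 : Tendsto (fun s => c * (s - t)) (𝓝[>] t) (𝓝 0) := by
    have : Tendsto (fun s => c * (s - t)) (𝓝 t) (𝓝 (c * (t - t))) := by
      exact (Continuous.tendsto (by fun_prop) t)
    simpa using this.mono_left nhdsWithin_le_nhds
  refine le_of_tendsto_of_tendsto h1 h2 ?_
  filter_upwards [Ioc_mem_nhdsGT htτ] with s hs
  have hpos : 0 < s - t := sub_pos.2 hs.1
  rw [slope_def_field, div_le_iff₀ hpos]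
  exact (h s hs.1.le hs.2).trans_eq (by ring)

namespace BlowupControl

variable {n : ℕ} {U : Type*}

/-- The support function `p ↦ sup_u ⟪p, b(t,u)⟫` of the velocity set `b(t,U)`. The supremum is taken
over a dense sequence in `U`, which makes it measurable in `t`; for admissible `b` and `t ≥ 0` it is
the supremum over `U`. -/
noncomputable def velocitySupport [TopologicalSpace U] [TopologicalSpace.SeparableSpace U]
    [Nonempty U] (b : ℝ → U → State n) (p : State n) (t : ℝ) : ℝ :=
  ⨆ i, ⟪p, b t (TopologicalSpace.denseSeq U i)⟫

section velocitySupport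

variable [TopologicalSpace U] [TopologicalSpace.SeparableSpace U] [Nonempty U]
  {b : ℝ → U → State n}

theorem inner_le_velocitySupport (hb : AdmissibleB b) (p : State n) {t : ℝ} (ht : 0 ≤ t) (u : U) :
    ⟪p, b t u⟫ ≤ velocitySupport b p t := by
  obtain ⟨R, hR⟩ := (hb.compact t ht).isBounded.exists_norm_le
  have hbdd : BddAbove (range fun i => ⟪p, b t (TopologicalSpace.denseSeq U i)⟫) := by
    refine ⟨‖p‖ * R, ?_⟩
    rintro _ ⟨i, rfl⟩
    exact (real_inner_le_norm _ _).trans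
      (mul_le_mul_of_nonneg_left (hR _ ⟨_, rfl⟩) (norm_nonneg _))
  have hcl : IsClosed {u | ⟪p, b t u⟫ ≤ velocitySupport b p t} :=
    isClosed_le (continuous_const.inner (hb.continuous t ht)) continuous_const
  refine (TopologicalSpace.denseRange_denseSeq U).induction_on u hcl fun i => ?_
  exact le_ciSup hbdd i

theorem intervalIntegrable_velocitySupport (hb : AdmissibleB b) (p : State n) {τ : ℝ}
    (hτ : 0 < τ) : IntervalIntegrable (velocitySupport b p) volume 0 τ := by
  obtain ⟨C, hC⟩ := hb.bounded τ hτ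
  rw [intervalIntegrable_iff_integrableOn_Icc_of_le hτ.le]
  refine Integrable.of_bound (C := ‖p‖ * C) ?_ ?_
  · have hm : AEMeasurable (velocitySupport b p) (volume.restrict (Icc 0 τ)) :=
      AEMeasurable.iSup fun i => AEMeasurable.const_inner <| (hb.measurable _).mono_measure <|
        Measure.restrict_mono Icc_subset_Ici_self le_rfl
    exact hm.aestronglyMeasurable
  · filter_upwards [hC] with t ht
    have hle : ∀ i, |⟪p, b t (TopologicalSpace.denseSeq U i)⟫| ≤ ‖p‖ * C := fun i =>
      (abs_real_inner_le_norm _ _).trans (mul_le_mul_of_nonneg_left (ht _) (norm_nonneg _))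
    rw [Real.norm_eq_abs, abs_le]
    have hbdd : BddAbove (range fun i => ⟪p, b t (TopologicalSpace.denseSeq U i)⟫) := by
      refine ⟨‖p‖ * C, ?_⟩
      rintro _ ⟨i, rfl⟩
      exact (abs_le.1 (hle i)).2
    exact ⟨(abs_le.1 (hle 0)).1.trans (le_ciSup hbdd 0), ciSup_le fun i => (abs_le.1 (hle i)).2⟩

end velocitySupport

section limit

variable {G : ℝ → ℝ → ℝ} {A : ℝ → Matrix (Fin n) (Fin n) ℝ}
  {b : ℝ → U → State n} {y₀ : State n} {ι : Type*} {l : Filter ι} [NeBot l]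
  {T : ι → ℝ} {y : ι → ℝ → State n} {u : ι → ℝ → U} {z : ℝ → State n} {τ M : ℝ}

theorem lipschitzOnWith_of_tendsto (hsol : ∀ k, IsSolution G A b y₀ (T k) (y k) (u k))
    {K : ℝ} (hK0 : 0 ≤ K) (hτM : τ ≤ M)
    (hK : ∀ᵐ t, t ∈ Icc 0 M → ∀ y : State n, ‖y‖ ≤ M → ∀ u, ‖rhs G A b t y u‖ ≤ K)
    (hbd : ∀ᶠ k in l, τ < T k ∧ ∀ t ∈ Icc 0 τ, ‖y k t‖ ≤ M)
    (hz : ∀ t ∈ Icc 0 τ, Tendsto (fun k => y k t) l (𝓝 (z t))) :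
    LipschitzOnWith K.toNNReal z (Icc 0 τ) := by
  have key : ∀ s ∈ Icc 0 τ, ∀ t ∈ Icc 0 τ, s ≤ t → ‖z t - z s‖ ≤ K * (t - s) := by
    intro s hs t ht hst
    refine le_of_tendsto ((hz t ht).sub (hz s hs)).norm ?_
    filter_upwards [hbd] with k hk
    exact (hsol k).norm_sub_le hK hs.1 hst (ht.2.trans_lt hk.1) (ht.2.trans hτM)
      fun r hr => hk.2 r ⟨hs.1.trans hr.1, hr.2.le.trans ht.2⟩
  refine LipschitzOnWith.of_dist_le_mul fun s hs t ht => ?_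
  rw [Real.coe_toNNReal _ hK0, dist_eq_norm, Real.dist_eq]
  rcases le_total s t with h | h
  · rw [norm_sub_rev, abs_sub_comm, abs_of_nonneg (sub_nonneg.2 h)]
    exact key s hs t ht h
  · rw [abs_of_nonneg (sub_nonneg.2 h)]
    exact key t ht s hs h

theorem intervalIntegrable_inner_drift (hG : AdmissibleG G) (hA : AdmissibleA A) (hM : 0 < M)
    (hτ : 0 < τ) (hτM : τ ≤ M) (hzc : ContinuousOn z (Icc 0 τ)) (hzM : ∀ t ∈ Icc 0 τ, ‖z t‖ ≤ M)
    (p : State n) : IntervalIntegrable (fun t => ⟪p, drift G A t (z t)⟫) volume 0 τ := by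
  obtain ⟨L, hL0, hL⟩ := exists_lipschitz_drift hG hA hM
  rw [intervalIntegrable_iff_integrableOn_Icc_of_le hτ.le]
  refine Integrable.of_bound (C := ‖p‖ * (L * M)) ?_ ?_
  · have hm : AEMeasurable (fun t => drift G A t (z t)) (volume.restrict (Icc 0 τ)) := by
      have hzm : AEStronglyMeasurable z (volume.restrict (Icc 0 τ)) :=
        hzc.aestronglyMeasurable measurableSet_Icc
      refine aemeasurable_comp_of_ae_continuous (fun x => (aemeasurable_drift hG hA x).mono_measure
        (Measure.restrict_mono Icc_subset_Ici_self le_rfl)) ?_ hzm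
      exact (ae_restrict_iff' measurableSet_Icc).2 (.of_forall fun t ht => continuous_drift hG ht.1)
    exact hm.const_inner.aestronglyMeasurable
  · refine (ae_restrict_iff' measurableSet_Icc).2 ?_
    filter_upwards [hL] with t ht htτ
    refine (norm_inner_le_norm _ _).trans (mul_le_mul_of_nonneg_left ?_ (norm_nonneg _))
    have := ht ⟨htτ.1, htτ.2.trans hτM⟩ (z t) 0 (hzM t htτ) (by simpa using hM.le)
    rw [drift_zero, sub_zero, sub_zero] at this
    exact this.trans (mul_le_mul_of_nonneg_left (hzM t htτ) hL0)

/-- The integrated form of the differential inclusion for a pointwise limit `z` of solutions. The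
quadratic error comes from replacing `yₖ` by `z` in the drift: on `[t, s]` the two differ by at most
`|yₖ t - z t| + 2K(s - t)`, since both are `K`-Lipschitz. -/
theorem inner_sub_le_integral_of_tendsto [TopologicalSpace U]
    [TopologicalSpace.SeparableSpace U] [Nonempty U] (hG : AdmissibleG G) (hA : AdmissibleA A)
    (hb : AdmissibleB b) (hM : 0 < M) (hτ : 0 < τ) (hτM : τ ≤ M)
    (hsol : ∀ k, IsSolution G A b y₀ (T k) (y k) (u k))
    (hbd : ∀ᶠ k in l, τ < T k ∧ ∀ t ∈ Icc 0 τ, ‖y k t‖ ≤ M)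
    (hz : ∀ t ∈ Icc 0 τ, Tendsto (fun k => y k t) l (𝓝 (z t))) (p : State n) :
    ∃ c, ∀ t s, 0 ≤ t → t ≤ s → s ≤ τ → ⟪p, z s - z t⟫ ≤
      (∫ r in t..s, (⟪p, drift G A r (z r)⟫ + velocitySupport b p r)) + c * (s - t) ^ 2 := by
  obtain ⟨K, hK0, hK⟩ := exists_bound_rhs hG hA hb hM
  obtain ⟨L, hL0, hL⟩ := exists_lipschitz_drift hG hA hM
  have hzl := lipschitzOnWith_of_tendsto hsol hK0 hτM hK hbd hz
  have hzM : ∀ t ∈ Icc 0 τ, ‖z t‖ ≤ M := fun t ht =>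
    le_of_tendsto (hz t ht).norm (hbd.mono fun k hk => hk.2 t ht)
  have hψ : IntervalIntegrable (fun r => ⟪p, drift G A r (z r)⟫ + velocitySupport b p r)
      volume 0 τ :=
    (intervalIntegrable_inner_drift hG hA hM hτ hτM hzl.continuousOn hzM p).add
      (intervalIntegrable_velocitySupport hb p hτ)
  refine ⟨‖p‖ * (L * (2 * K)), fun t s ht hts hsτ => ?_⟩
  have htτ : t ∈ Icc 0 τ := ⟨ht, hts.trans hsτ⟩
  have hψ' : IntervalIntegrable (fun r => ⟪p, drift G A r (z r)⟫ + velocitySupport b p r)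
      volume t s := hψ.mono_set (by
    rw [uIcc_of_le hts, uIcc_of_le hτ.le]; exact Icc_subset_Icc ht hsτ)
  set I := ∫ r in t..s, (⟪p, drift G A r (z r)⟫ + velocitySupport b p r) with hI
  have hk : ∀ᶠ k in l, ⟪p, y k s - y k t⟫ ≤
      I + ‖p‖ * (L * (‖y k t - z t‖ + 2 * K * (s - t))) * (s - t) := by
    filter_upwards [hbd] with k hk
    obtain ⟨hi, he⟩ := (hsol k).sub_eq_integral ht hts (hsτ.trans_lt hk.1)
    set e := ‖p‖ * (L * (‖y k t - z t‖ + 2 * K * (s - t))) with hedef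
    have hr : I + e * (s - t) =
        ∫ r in t..s, (⟪p, drift G A r (z r)⟫ + velocitySupport b p r + e) := by
      rw [intervalIntegral.integral_add hψ' intervalIntegrable_const,
        intervalIntegral.integral_const, smul_eq_mul, mul_comm e]
    have hl : ⟪p, y k s - y k t⟫ = ∫ r in t..s, ⟪p, rhs G A b r (y k r) (u k r)⟫ := by
      rw [he]
      exact ((innerSL ℝ p).intervalIntegral_comp_comm hi).symm
    rw [hr, hl]
    refine intervalIntegral.integral_mono_ae_restrict hts
      ⟨hi.1.const_inner p, hi.2.const_inner p⟩ (hψ'.add intervalIntegrable_const) ?_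
    refine (ae_restrict_iff' measurableSet_Icc).2 ?_
    filter_upwards [hL] with r hLr hr
    have hrτ : r ∈ Icc 0 τ := ⟨ht.trans hr.1, hr.2.trans hsτ⟩
    have h1 : ‖y k r - z r‖ ≤ ‖y k t - z t‖ + 2 * K * (s - t) := by
      have h2 : ‖y k r - y k t‖ ≤ K * (r - t) :=
        (hsol k).norm_sub_le hK ht hr.1 (hrτ.2.trans_lt hk.1) (hrτ.2.trans hτM)
          fun q hq => hk.2 q ⟨ht.trans hq.1, hq.2.le.trans hrτ.2⟩
      have h3 : ‖z r - z t‖ ≤ K * (r - t) := by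
        have := hzl.dist_le_mul r hrτ t htτ
        rwa [Real.coe_toNNReal _ hK0, dist_eq_norm, Real.dist_eq,
          abs_of_nonneg (sub_nonneg.2 hr.1)] at this
      have h4 : y k r - z r = (y k t - z t) + ((y k r - y k t) - (z r - z t)) := by abel
      have h5 : K * (r - t) ≤ K * (s - t) := mul_le_mul_of_nonneg_left (by linarith [hr.2]) hK0
      rw [h4]
      refine (norm_add_le _ _).trans ?_
      linarith [norm_sub_le (y k r - y k t) (z r - z t)]
    have h6 : ⟪p, drift G A r (y k r)⟫ ≤ ⟪p, drift G A r (z r)⟫ + e := by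
      have e1 : ⟪p, drift G A r (y k r)⟫ =
          ⟪p, drift G A r (z r)⟫ + ⟪p, drift G A r (y k r) - drift G A r (z r)⟫ := by
        rw [inner_sub_right]; ring
      rw [e1]
      refine add_le_add_right ((real_inner_le_norm _ _).trans
        (mul_le_mul_of_nonneg_left ?_ (norm_nonneg _))) _
      exact (hLr ⟨hrτ.1, hrτ.2.trans hτM⟩ _ _ (hk.2 r hrτ) (hzM r hrτ)).trans
        (mul_le_mul_of_nonneg_left h1 hL0)
    change ⟪p, drift G A r (y k r) + b r (u k r)⟫ ≤ _
    rw [inner_add_right]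
    linarith [inner_le_velocitySupport hb p hrτ.1 (u k r)]
  have hlim := le_of_tendsto_of_tendsto
    ((tendsto_const_nhds (x := p)).inner ((hz s ⟨ht.trans hts, hsτ⟩).sub (hz t htτ)))
    (((((tendsto_iff_norm_sub_tendsto_zero.1 (hz t htτ)).add_const _).const_mul L).const_mul
      ‖p‖).mul_const (s - t) |>.const_add I) hk
  refine hlim.trans_eq ?_
  ring

/-- A pointwise limit of solutions solves the differential inclusion `z' ∈ drift + b(t,U)`. -/
theorem ae_deriv_sub_drift_mem_range [TopologicalSpace U]
    [TopologicalSpace.SeparableSpace U] [Nonempty U] (hG : AdmissibleG G) (hA : AdmissibleA A)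
    (hb : AdmissibleB b) (hM : 0 < M) (hτ : 0 < τ) (hτM : τ ≤ M)
    (hsol : ∀ k, IsSolution G A b y₀ (T k) (y k) (u k))
    (hbd : ∀ᶠ k in l, τ < T k ∧ ∀ t ∈ Icc 0 τ, ‖y k t‖ ≤ M)
    (hz : ∀ t ∈ Icc 0 τ, Tendsto (fun k => y k t) l (𝓝 (z t))) :
    ∀ᵐ t, t ∈ Icc 0 τ → deriv z t - drift G A t (z t) ∈ range (b t) := by
  obtain ⟨K, hK0, hK⟩ := exists_bound_rhs hG hA hb hM
  have hzl := lipschitzOnWith_of_tendsto hsol hK0 hτM hK hbd hz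
  have hzM : ∀ t ∈ Icc 0 τ, ‖z t‖ ≤ M := fun t ht =>
    le_of_tendsto (hz t ht).norm (hbd.mono fun k hk => hk.2 t ht)
  set D := TopologicalSpace.denseSeq (State n)
  have hψ : ∀ k, IntervalIntegrable
      (fun r => ⟪D k, drift G A r (z r)⟫ + velocitySupport b (D k) r) volume 0 τ := fun k =>
    (intervalIntegrable_inner_drift hG hA hM hτ hτM hzl.continuousOn hzM _).add
      (intervalIntegrable_velocitySupport hb _ hτ)
  have hne : ∀ c : ℝ, ∀ᵐ x : ℝ, x ≠ c := fun c => by simp [ae_iff, measure_singleton]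
  filter_upwards [hzl.ae_differentiableWithinAt_of_mem (μ := volume), hne 0, hne τ,
    ae_all_iff.2 fun k => (hψ k).ae_hasDerivAt_integral] with t hdiff ht0 htτ hint ht
  have hnhds : Icc 0 τ ∈ 𝓝 t :=
    Icc_mem_nhds (lt_of_le_of_ne ht.1 ht0.symm) (lt_of_le_of_ne ht.2 htτ)
  have hderiv : HasDerivAt z (deriv z t) t := ((hdiff ht).differentiableAt hnhds).hasDerivAt
  refine mem_of_forall_inner_le_iSup (hb.convex t ht.1) (hb.compact t ht.1)
    (TopologicalSpace.denseRange_denseSeq (State n))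
    (c := fun i => b t (TopologicalSpace.denseSeq U i)) (fun i => mem_range_self _) fun k => ?_
  obtain ⟨c, hc⟩ :=
    inner_sub_le_integral_of_tendsto hG hA hb hM hτ hτM hsol hbd hz (D k)
  have hF : HasDerivAt (fun x => ⟪D k, z x⟫ -
      ∫ r in (0 : ℝ)..x, (⟪D k, drift G A r (z r)⟫ + velocitySupport b (D k) r))
      (⟪D k, deriv z t⟫ - (⟪D k, drift G A t (z t)⟫ + velocitySupport b (D k) t)) t :=
    ((innerSL ℝ (D k)).hasFDerivAt.comp_hasDerivAt t hderiv).sub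
      (hint k (by rwa [uIcc_of_le hτ.le]) 0 (by simp))
  have hle := hF.nonpos_of_sub_le_sq (lt_of_le_of_ne ht.2 htτ) (c := c) fun s hts hsτ => by
    have hsub : ∀ x ∈ Icc 0 τ, IntervalIntegrable
        (fun r => ⟪D k, drift G A r (z r)⟫ + velocitySupport b (D k) r) volume 0 x :=
      fun x hx => (hψ k).mono_set (by
        rw [uIcc_of_le hx.1, uIcc_of_le hτ.le]; exact Icc_subset_Icc le_rfl hx.2)
    have h1 := hc t s ht.1 hts hsτ
    rw [← intervalIntegral.integral_interval_sub_left (hsub s ⟨ht.1.trans hts, hsτ⟩) (hsub t ht),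
      inner_sub_right] at h1
    linarith
  change ⟪D k, _⟫ ≤ velocitySupport b (D k) t
  rw [inner_sub_right]
  linarith

end limit

/-! ### Existence of a fastest blowup -/

theorem IsSolution.apply_zero {G : ℝ → ℝ → ℝ} {A : ℝ → Matrix (Fin n) (Fin n) ℝ}
    {b : ℝ → U → State n} {y₀ : State n} {T : ℝ} {y : ℝ → State n} {u : ℝ → U}
    (h : IsSolution G A b y₀ T y u) (hT : 0 < T) : y 0 = y₀ := by
  simpa using (h.2 0 ⟨le_rfl, hT⟩).2

theorem continuousOn_of_locally_lipschitz {E : Type*} [PseudoEMetricSpace E] {T : ℝ} {z : ℝ → E}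
    (hz : ∀ τ ∈ Ioo 0 T, ∃ K, LipschitzOnWith K z (Icc 0 τ)) : ContinuousOn z (Ico 0 T) := by
  intro t ht
  obtain ⟨τ, htτ, hτT⟩ := exists_between ht.2
  obtain ⟨K, hK⟩ := hz τ ⟨ht.1.trans_lt htτ, hτT⟩
  refine (hK.continuousOn t ⟨ht.1, htτ.le⟩).mono_of_mem_nhdsWithin ?_
  filter_upwards [self_mem_nhdsWithin, mem_nhdsWithin_of_mem_nhds (Iio_mem_nhds htτ)]
    with r hr hrτ
  exact ⟨hr.1, le_of_lt hrτ⟩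

theorem isSolution_of_locally_lipschitz {G : ℝ → ℝ → ℝ} {A : ℝ → Matrix (Fin n) (Fin n) ℝ}
    {b : ℝ → U → State n} {T : ℝ} {z : ℝ → State n} {u : ℝ → U}
    (hz : ∀ τ ∈ Ioo 0 T, ∃ K, LipschitzOnWith K z (Icc 0 τ))
    (hu : ∀ᵐ t, t ∈ Ico 0 T → rhs G A b t (z t) (u t) = deriv z t) :
    IsSolution G A b (z 0) T z u := by
  refine ⟨continuousOn_of_locally_lipschitz hz, fun t ht => ?_⟩
  obtain ⟨τ, htτ, hτT⟩ := exists_between ht.2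
  obtain ⟨K, hK⟩ := hz τ ⟨ht.1.trans_lt htτ, hτT⟩
  obtain ⟨h1, h2⟩ :=
    (hK.mono (Icc_subset_Icc le_rfl htτ.le)).intervalIntegrable_deriv_and_integral_eq ht.1
  have hcongr : ∀ᵐ r, r ∈ uIoc 0 t → deriv z r = rhs G A b r (z r) (u r) := by
    filter_upwards [hu] with r hr hrt
    rw [uIoc_of_le ht.1] at hrt
    exact (hr ⟨hrt.1.le, hrt.2.trans_lt ht.2⟩).symm
  refine ⟨h1.congr_ae ((ae_restrict_iff' measurableSet_uIoc).2 hcongr), ?_⟩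
  rw [← intervalIntegral.integral_congr_ae hcongr, h2]
  abel

theorem exists_control_of_inclusion [TopologicalSpace U] [MeasurableSpace U] [BorelSpace U]
    {G : ℝ → ℝ → ℝ} {A : ℝ → Matrix (Fin n) (Fin n) ℝ} {b : ℝ → U → State n}
    (hU : AnalyticSet (univ : Set U)) (u₀ : U) (hG : AdmissibleG G) (hA : AdmissibleA A)
    (hb : AdmissibleB b) {T : ℝ} {z : ℝ → State n} (hz : ContinuousOn z (Ico 0 T))
    (hinc : ∀ᵐ t, t ∈ Ico 0 T → deriv z t - drift G A t (z t) ∈ range (b t)) :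
    ∃ u : ℝ → U, Measurable u ∧ ∀ᵐ t, t ∈ Ico 0 T → rhs G A b t (z t) (u t) = deriv z t := by
  have hmono : volume.restrict (Ico 0 T) ≤ volume.restrict (Ici (0 : ℝ)) :=
    Measure.restrict_mono Ico_subset_Ici_self le_rfl
  have hzm : AEStronglyMeasurable z (volume.restrict (Ico 0 T)) :=
    hz.aestronglyMeasurable measurableSet_Ico
  have hd : AEMeasurable (fun t => drift G A t (z t)) (volume.restrict (Ico 0 T)) :=
    aemeasurable_comp_of_ae_continuous
      (fun x => (aemeasurable_drift hG hA x).mono_measure hmono)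
      ((ae_restrict_iff' measurableSet_Ico).2 (.of_forall fun t ht => continuous_drift hG ht.1))
      hzm
  obtain ⟨u, hu, hub⟩ := exists_measurable_selection (volume.restrict (Ico 0 T)) hU u₀
    (fun w => (hb.measurable w).mono_measure hmono)
    ((ae_restrict_iff' measurableSet_Ico).2 (.of_forall fun t ht => hb.continuous t ht.1))
    ((measurable_deriv z).aemeasurable.sub hd)
    ((ae_restrict_iff' measurableSet_Ico).2 hinc)
  refine ⟨u, hu, ?_⟩
  filter_upwards [(ae_restrict_iff' measurableSet_Ico).1 hub] with t ht htT
  rw [rhs_eq_drift_add, ht htT]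
  simp

/-- Lower semicontinuity of the blowup time: if the blowup times of admissible triples converge
along an ultrafilter, some admissible triple blows up no later than the limit. -/
theorem exists_admissible_le_of_tendsto [TopologicalSpace U] [TopologicalSpace.SeparableSpace U]
    [MeasurableSpace U] [BorelSpace U] (hU : AnalyticSet (univ : Set U)) (u₀ : U)
    {G : ℝ → ℝ → ℝ} {A : ℝ → Matrix (Fin n) (Fin n) ℝ} {b : ℝ → U → State n} {y₀ : State n}
    (hG : AdmissibleG G) (hA : AdmissibleA A) (hb : AdmissibleB b) {ι : Type*} (l : Ultrafilter ι)
    {T : ι → ℝ} {y : ι → ℝ → State n} {u : ι → ℝ → U}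
    (hadm : ∀ k, (T k, y k, u k) ∈ Admissible G A b y₀) {Tlim : ℝ}
    (hT : Tendsto T l (𝓝 Tlim)) : ∃ p ∈ Admissible G A b y₀, p.1 ≤ Tlim := by
  have : Nonempty U := ⟨u₀⟩
  have hT0 : ∀ k, 0 < T k := fun k => (hadm k).1.1
  have hsol : ∀ k, IsSolution G A b y₀ (T k) (y k) (u k) := fun k => (hadm k).1.2.2
  set S : Set ℝ := {s | 0 ≤ s ∧ ∃ M, ∀ᶠ k in l, ∀ t ∈ Icc 0 s, t < T k → ‖y k t‖ ≤ M}
  -- a bounded trajectory has not blown up yet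
  have hlt : ∀ s ∈ S, ∀ᶠ k in l, s < T k := by
    rintro s ⟨-, M, hM⟩
    filter_upwards [hM] with k hk
    by_contra! hle
    have h1 : ∀ᶠ t in 𝓝[<] T k, M < ‖y k t‖ := (hadm k).2.eventually_gt_atTop M
    obtain ⟨t, ht, ht'⟩ := (h1.and (Ioo_mem_nhdsLT (hT0 k))).exists
    exact ht.not_ge (hk t ⟨ht'.1.le, ht'.2.le.trans hle⟩ ht'.2)
  have hSle : ∀ s ∈ S, s ≤ Tlim := fun s hs =>
    ge_of_tendsto hT ((hlt s hs).mono fun k hk => hk.le)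
  -- the increment `δ` depends on the bound at time `s` alone, not on the bound over `[0, s]`
  have hstep : ∀ R, ∃ δ, 0 < δ ∧ ∀ s ∈ S, (∀ᶠ k in l, ‖y k s‖ ≤ R) → s + δ ∈ S := by
    intro R
    obtain ⟨δ, hδ, h⟩ := exists_uniform_step hG hA hb R Tlim
    refine ⟨δ, hδ, fun s hs hR => ?_⟩
    obtain ⟨hs0, M, hM⟩ := id hs
    refine ⟨by positivity, max M (R + 1), ?_⟩
    filter_upwards [hM, hR] with k hk hkR t ht htT
    rcases le_total t s with hts | hst
    · exact (hk t ⟨ht.1, hts⟩ htT).trans (le_max_left _ _)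
    · exact (h y₀ (T k) (y k) (u k) (hsol k) s hs0 (hSle s hs) hkR t hst ht.2 htT).trans
        (le_max_right _ _)
  have hbd : ∀ s ∈ S, ∃ M, 0 < M ∧ s ≤ M ∧
      ∀ᶠ k in l, s < T k ∧ ∀ t ∈ Icc 0 s, ‖y k t‖ ≤ M := by
    intro s hs
    obtain ⟨hs0, M, hM⟩ := id hs
    refine ⟨max M (s + 1), lt_max_of_lt_right (by positivity),
      le_max_of_le_right (by linarith), ?_⟩
    filter_upwards [hM, hlt s hs] with k hk hsk
    exact ⟨hsk, fun t ht => (hk t ht (ht.2.trans_lt hsk)).trans (le_max_left _ _)⟩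
  have hSopen : ∀ s ∈ S, ∃ δ, 0 < δ ∧ s + δ ∈ S := by
    intro s hs
    obtain ⟨M, -, -, hM⟩ := hbd s hs
    obtain ⟨δ, hδ, h⟩ := hstep M
    exact ⟨δ, hδ, h s hs (hM.mono fun k hk => hk.2 s ⟨hs.1, le_rfl⟩)⟩
  have h0S : (0 : ℝ) ∈ S := by
    refine ⟨le_rfl, ‖y₀‖, .of_forall fun k t ht _ => ?_⟩
    rw [le_antisymm ht.2 ht.1, (hsol k).apply_zero (hT0 k)]
  have hSbdd : BddAbove S := ⟨Tlim, hSle⟩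
  set τ := sSup S
  have hltτ : ∀ s ∈ S, s < τ := by
    intro s hs
    obtain ⟨δ, hδ, h⟩ := hSopen s hs
    exact (lt_add_of_pos_right s hδ).trans_le (le_csSup hSbdd h)
  have hτ0 : 0 < τ := hltτ 0 h0S
  have hmemS : ∀ t ∈ Ico 0 τ, t ∈ S := by
    intro t ht
    obtain ⟨s, ⟨-, M, hM⟩, hts⟩ := exists_lt_of_lt_csSup ⟨0, h0S⟩ ht.2
    exact ⟨ht.1, M, hM.mono fun k hk r hr => hk r ⟨hr.1, hr.2.trans hts.le⟩⟩
  have hex : ∀ t, t ∈ Ico 0 τ → ∃ x, Tendsto (fun k => y k t) l (𝓝 x) := by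
    intro t ht
    obtain ⟨M, -, -, hM⟩ := hbd t (hmemS t ht)
    obtain ⟨x, -, hx⟩ := (isCompact_closedBall (0 : State n) M).ultrafilter_le_nhds'
      (l.map fun k => y k t) (by
        rw [Ultrafilter.mem_map]
        filter_upwards [hM] with k hk
        simpa using hk.2 t ⟨ht.1, le_rfl⟩)
    exact ⟨x, hx⟩
  choose! z hz using hex
  have hz0 : z 0 = y₀ := by
    refine tendsto_nhds_unique (hz 0 ⟨le_rfl, hτ0⟩) (tendsto_const_nhds.congr fun k => ?_)
    exact ((hsol k).apply_zero (hT0 k)).symm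
  have hzlip : ∀ s ∈ Ioo 0 τ, ∃ K, LipschitzOnWith K z (Icc 0 s) := by
    intro s hs
    obtain ⟨M, hM0, hsM, hM⟩ := hbd s (hmemS s ⟨hs.1.le, hs.2⟩)
    obtain ⟨K, hK0, hK⟩ := exists_bound_rhs hG hA hb hM0
    exact ⟨_, lipschitzOnWith_of_tendsto hsol hK0 hsM hK hM
      fun t ht => hz t ⟨ht.1, ht.2.trans_lt hs.2⟩⟩
  have hinc : ∀ᵐ t, t ∈ Ico 0 τ → deriv z t - drift G A t (z t) ∈ range (b t) := by
    obtain ⟨s, -, hsτ, hs⟩ := exists_seq_strictMono_tendsto' hτ0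
    have hall : ∀ᵐ t, ∀ j, t ∈ Icc 0 (s j) → deriv z t - drift G A t (z t) ∈ range (b t) := by
      refine ae_all_iff.2 fun j => ?_
      obtain ⟨M, hM0, hsM, hM⟩ := hbd (s j) (hmemS _ ⟨(hsτ j).1.le, (hsτ j).2⟩)
      exact ae_deriv_sub_drift_mem_range hG hA hb hM0 (hsτ j).1 hsM hsol hM
        fun t ht => hz t ⟨ht.1, ht.2.trans_lt (hsτ j).2⟩
    filter_upwards [hall] with t ht htτ
    obtain ⟨j, hj⟩ := (hs.eventually_const_lt htτ.2).exists
    exact ht j ⟨htτ.1, hj.le⟩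
  obtain ⟨v, hv, hvz⟩ := exists_control_of_inclusion hU u₀ hG hA hb
    (continuousOn_of_locally_lipschitz hzlip) hinc
  refine ⟨(τ, z, v), ⟨⟨hτ0, hv.aemeasurable,
    hz0 ▸ isSolution_of_locally_lipschitz hzlip hvz⟩, ?_⟩, csSup_le ⟨0, h0S⟩ hSle⟩
  -- if `z` took values below `R` arbitrarily close to `τ`, one of them would be at a distance less
  -- than `δ` from `τ`, and `S` would reach beyond `τ`
  refine tendsto_atTop.2 fun R => ?_
  by_contra hcon
  obtain ⟨δ, hδ, h⟩ := hstep R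
  have hfr : ∃ᶠ t in 𝓝[<] τ, ‖z t‖ < R := by
    simpa only [not_eventually, not_le] using hcon
  obtain ⟨t, htR, ht⟩ := (hfr.and_eventually
    (Ioo_mem_nhdsLT (max_lt hτ0 (sub_lt_self τ hδ)))).exists
  have ht' : t ∈ Ico 0 τ := ⟨(le_max_left _ _).trans ht.1.le, ht.2⟩
  have hmem := h t (hmemS t ht')
    (((hz t ht').norm.eventually_lt_const htR).mono fun k hk => hk.le)
  linarith [hltτ _ hmem, (le_max_right 0 (τ - δ)).trans_lt ht.1]

end BlowupControl

theorem theorem2p1 {n : ℕ} {U : Type*} [MetricSpace U] [TopologicalSpace.SeparableSpace U]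
    [MeasurableSpace U] [BorelSpace U]
    (hU : MeasureTheory.AnalyticSet (Set.univ : Set U))
    (G : ℝ → ℝ → ℝ) (A : ℝ → Matrix (Fin n) (Fin n) ℝ)
    (b : ℝ → U → BlowupControl.State n) (y₀ : BlowupControl.State n)
    (hG : BlowupControl.AdmissibleG G) (hA : BlowupControl.AdmissibleA A)
    (hb : BlowupControl.AdmissibleB b)
    (hne : (BlowupControl.Admissible G A b y₀).Nonempty) :
    ∃ p : ℝ × (ℝ → BlowupControl.State n) × (ℝ → U),
      BlowupControl.IsOptimalTI G A b y₀ p := by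
  have hbdd : BddBelow (Prod.fst '' BlowupControl.Admissible G A b y₀) := by
    refine ⟨0, ?_⟩
    rintro _ ⟨p, hp, rfl⟩
    exact hp.1.1.le
  obtain ⟨T, -, hT, hTmem⟩ := exists_seq_tendsto_sInf (hne.image Prod.fst) hbdd
  choose p hp hpT using hTmem
  obtain rfl : (fun k => (p k).1) = T := funext hpT
  obtain ⟨q, hq, hqle⟩ := BlowupControl.exists_admissible_le_of_tendsto hU (hne.some.2.2 0)
    hG hA hb (Filter.hyperfilter ℕ) (T := fun k => (p k).1) (y := fun k => (p k).2.1)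
    (u := fun k => (p k).2.2) hp (hT.mono_left Nat.hyperfilter_le_atTop)
  refine ⟨q, hq, ?_⟩
  rw [le_antisymm hqle (csInf_le hbdd ⟨q, hq, rfl⟩)]
  exact isGLB_csInf (hne.image Prod.fst) hbdd
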